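/- Let $S^{d-1}$ be the unit sphere of $\mathbb{R}^d$ with surface measure $\sigma$. A non-empty finite set $X \subset S^{d-1}$ is a spherical $t$-design if $\frac{1}{|X|}\sum_{x\in X} f(x) = \frac{1}{\sigma(S^{d-1})}\int_{S^{d-1}} f\,d\sigma$ for every real polynomial $f$ in $d$ variables of total degree at most $t$. For a positive integer $m$, a finite set $X \subset S^{d-1}$ is called an $m$-stiff configuration if it is a spherical $(2m-1)$-design and there is a point $z \in S^{d-1}$ such that the set of inner products $\{\langle z,x\rangle : x \in X\}$ has at most $m$ elements. Theorem. Let $n \geq 1$ be an integer. There exists a $2n$-stiff configuration in $S^5$ if and only if $n = 1$. -/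

import Mathlib

open MeasureTheory

noncomputable section

/-- The unit sphere `S^{d-1}` of the Euclidean space `ℝ^d`. -/
abbrev UnitSphere (d : ℕ) : Type :=
  Metric.sphere (0 : EuclideanSpace ℝ (Fin d)) 1

/-- The surface measure on `S^{d-1}` (not normalized). -/
def surfaceMeasure (d : ℕ) : Measure (UnitSphere d) :=
  (volume : Measure (EuclideanSpace ℝ (Fin d))).toSphere

/-- The value at a point of `S^{d-1}` of a real polynomial in `d` variables. -/
def evalOnSphere {d : ℕ} (f : MvPolynomial (Fin d) ℝ) (x : UnitSphere d) : ℝ :=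
  MvPolynomial.eval (fun i => (x : EuclideanSpace ℝ (Fin d)) i) f

/-- A spherical `t`-design: a non-empty finite subset `X` of `S^{d-1}` such that the mean over `X`
of every polynomial of degree at most `t` is its mean over the sphere,
`(1 / |X|) ∑_{x ∈ X} f x = (1 / |S^{d-1}|) ∫_{S^{d-1}} f`. -/
def IsSphericalDesign {d : ℕ} (t : ℕ) (X : Finset (UnitSphere d)) : Prop :=
  X.Nonempty ∧ ∀ f : MvPolynomial (Fin d) ℝ, f.totalDegree ≤ t →
    (1 / (X.card : ℝ)) * ∑ x ∈ X, evalOnSphere f x =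
      (1 / (surfaceMeasure d).real Set.univ) * ∫ x, evalOnSphere f x ∂(surfaceMeasure d)

/-- `D(z, X)`, the set of inner products of `z` with the points of `X`. -/
def innerProducts {d : ℕ} (z : UnitSphere d) (X : Finset (UnitSphere d)) : Finset ℝ :=
  X.image fun x : UnitSphere d => inner ℝ (z : EuclideanSpace ℝ (Fin d)) (x : EuclideanSpace ℝ (Fin d))

/-- For a positive integer `m`, a finite subset `X` of `S^{d-1}` is `m`-stiff if it is a spherical
`(2m-1)`-design and some point `z` of the sphere has at most `m` distinct inner products with
the points of `X`. -/
def IsStiff {d : ℕ} (m : ℕ) (X : Finset (UnitSphere d)) : Prop :=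
  0 < m ∧ IsSphericalDesign (2 * m - 1) X ∧ ∃ z : UnitSphere d, (innerProducts z X).card ≤ m

end

/-! Nonexistence for n ≥ 2. Let a point z have 2n inner products t with X, each occurring W(t)
times. The design property makes W annihilate (1 - t²)g' - 5tg whenever deg g ≤ 4n - 2
(`IsSphericalDesign.sum_pearson`). So W is, up to scale, the Gauss quadrature for the weight (1 -
t²)^{3/2}: the nodes are the roots of the Gegenbauer polynomial P = U_{2n+1}'
(`gegenbauer_roots_eq`), and W(t) is proportional to (1 - t²)(M - (M - 1)t²) with M = (2n + 2)²
(`weights_mul_gaussWeight_eq`).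

Since the W(t) are integers and P is rational, this quadratic in t² takes rational values at the
nodes. If 4t² were irrational, its conjugate would also come from a root of P, but it exceeds 4,
while all nodes lie in [-1, 1]. So every 4t² is rational (`four_mul_sq_rational`). The polynomial q
whose roots are the 4t² has leading coefficient 2n + 1, prime to the next coefficient, and none of
the 4t² is an integer. Hence each rational 4t² has a prime factor of 2n + 1 in its denominator, and
each prime serves at most one root. This leaves fewer than n values (`card_lt_of_rational`), whereas
2n nodes give at least n.

For n = 1 the vertices of the cube form a 3-design with only two inner products with a coordinate
vector. -/

/-! ### Denominators of rational roots of integer polynomials -/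

open Polynomial in
/-- The reciprocal of a rational number whose denominator is divisible by `p`, as a `p`-adic integer
of norm less than one. -/
theorem exists_padicInt_inv_of_dvd_den (p : ℕ) [Fact p.Prime] {x : ℚ} (hx : p ∣ x.den) :
    ∃ v : ℤ_[p], ‖v‖ < 1 ∧ (v : ℚ_[p]) = ((x⁻¹ : ℚ) : ℚ_[p]) := by
  have hnum : ‖((x.num : ℤ) : ℚ_[p])‖ = 1 := by
    refine le_antisymm (Padic.norm_int_le_one _) (not_lt.1 fun h => ?_)
    rw [Padic.norm_intCast_lt_one_iff] at h
    have h1 : p ∣ x.num.natAbs := Int.natCast_dvd.1 h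
    have := Nat.dvd_gcd h1 hx
    rw [x.reduced] at this
    exact (Fact.out : p.Prime).one_lt.ne' (Nat.dvd_one.1 this)
  have hden : ‖((x.den : ℤ) : ℚ_[p])‖ < 1 := by
    rw [Padic.norm_intCast_lt_one_iff]
    exact_mod_cast hx
  have hnorm : ‖((x⁻¹ : ℚ) : ℚ_[p])‖ < 1 := by
    have : ((x⁻¹ : ℚ) : ℚ_[p]) = ((x.den : ℤ) : ℚ_[p]) / ((x.num : ℤ) : ℚ_[p]) := by
      conv_lhs => rw [← Rat.num_div_den x]
      push_cast
      rw [inv_div]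
    rw [this, norm_div, hnum, div_one]
    exact hden
  exact ⟨⟨_, hnorm.le⟩, hnorm, rfl⟩

open Polynomial in
/-- The reciprocal of a root is a root of the reflected polynomial, also `p`-adically. -/
theorem eval_reflect_padicInt {q : ℤ[X]} {n : ℕ} (hdeg : q.natDegree ≤ n) (p : ℕ) [Fact p.Prime]
    {x : ℚ} (hx0 : x ≠ 0) (hx : aeval x q = 0) {v : ℤ_[p]}
    (hv : (v : ℚ_[p]) = ((x⁻¹ : ℚ) : ℚ_[p])) :
    ((q.reflect n).map (Int.castRingHom ℤ_[p])).eval v = 0 := by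
  let _ : Invertible x := invertibleOfNonzero hx0
  have h1 : eval₂ (Int.castRingHom ℚ) x⁻¹ (q.reflect n) = 0 := by
    have := (eval₂_reflect_eq_zero_iff (Int.castRingHom ℚ) x n q hdeg).2 hx
    rwa [invOf_eq_inv] at this
  apply Subtype.coe_injective
  have h2 := congrArg (algebraMap ℚ ℚ_[p]) h1
  rw [hom_eval₂, map_zero, eq_ratCast, ← hv] at h2
  have h3 := hom_eval₂ (q.reflect n) (Int.castRingHom ℤ_[p]) (PadicInt.Coe.ringHom) v
  rw [eval_map]
  refine h3.trans ((Eq.trans ?_ h2).trans PadicInt.coe_zero.symm)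
  congr 1

-- The reciprocal v of x is a root, of norm less than one, of the reflected polynomial; hence v
-- divides its constant term, which is `q.coeff n`.
open Polynomial in
theorem dvd_coeff_of_dvd_den {q : ℤ[X]} {n : ℕ} (hdeg : q.natDegree ≤ n) {p : ℕ} (hp : p.Prime)
    {x : ℚ} (hx : aeval x q = 0) (hxp : p ∣ x.den) : (p : ℤ) ∣ q.coeff n := by
  have : Fact p.Prime := ⟨hp⟩
  have hx0 : x ≠ 0 := by
    rintro rfl
    exact hp.one_lt.ne' (Nat.dvd_one.1 (by simpa using hxp))
  obtain ⟨v, hv, hvx⟩ := exists_padicInt_inv_of_dvd_den p hxp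
  have h := eval_reflect_padicInt hdeg p hx0 hx hvx
  set r := (q.reflect n).map (Int.castRingHom ℤ_[p]) with hr
  have h0 : r.eval 0 = (q.coeff n : ℤ_[p]) := by
    rw [← coeff_zero_eq_eval_zero, hr, coeff_map, coeff_reflect, revAt_le (Nat.zero_le n)]
    simp
  have hd : v - 0 ∣ r.eval v - r.eval 0 := sub_dvd_eval_sub v 0 r
  rw [h, h0, sub_zero, zero_sub, dvd_neg] at hd
  obtain ⟨k, hk⟩ := hd
  rw [← PadicInt.norm_int_lt_one_iff_dvd, hk, norm_mul]
  exact mul_lt_one_of_nonneg_of_lt_one_left (norm_nonneg _) hv (PadicInt.norm_le_one k)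

open Polynomial in
/-- If `p` does not divide the coefficient below the leading one, at most one rational root has
denominator divisible by `p`. -/
theorem eq_of_dvd_den {q : ℤ[X]} {n : ℕ} (hn : 1 ≤ n) (hdeg : q.natDegree ≤ n) {p : ℕ}
    (hp : p.Prime) (hcoeff : ¬ (p : ℤ) ∣ q.coeff (n - 1)) {x y : ℚ} (hx : aeval x q = 0)
    (hy : aeval y q = 0) (hxp : p ∣ x.den) (hyp : p ∣ y.den) : x = y := by
  have : Fact p.Prime := ⟨hp⟩
  have ne0 : ∀ {z : ℚ}, p ∣ z.den → z ≠ 0 := by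
    rintro z hz rfl
    exact hp.one_lt.ne' (Nat.dvd_one.1 (by simpa using hz))
  obtain ⟨v, hv, hvx⟩ := exists_padicInt_inv_of_dvd_den p hxp
  obtain ⟨w, hw, hwy⟩ := exists_padicInt_inv_of_dvd_den p hyp
  have hv0 := eval_reflect_padicInt hdeg p (ne0 hxp) hx hvx
  have hw0 := eval_reflect_padicInt hdeg p (ne0 hyp) hy hwy
  set r := (q.reflect n).map (Int.castRingHom ℤ_[p]) with hr
  by_contra hxy
  have hvw : w - v ≠ 0 := by
    intro h
    have h2 : (w : ℚ_[p]) = v := by rw [sub_eq_zero.1 h]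
    rw [hvx, hwy] at h2
    exact hxy (inv_injective (by exact_mod_cast h2.symm))
  have h0 : r.derivative.eval 0 = (q.coeff (n - 1) : ℤ_[p]) := by
    rw [← coeff_zero_eq_eval_zero, coeff_derivative, hr, coeff_map, coeff_reflect, zero_add,
      revAt_le hn]
    simp
  -- Uniqueness as in Hensel's lemma: two distinct roots v, w in the maximal ideal make r'(v) a
  -- multiple of w - v, and r'(v) ≡ r'(0) mod v, so p would divide r'(0) = `q.coeff (n - 1)`.
  obtain ⟨k, hk⟩ := binomExpansion r v (w - v)
  rw [add_sub_cancel, hv0, hw0, zero_add] at hk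
  have hk' : r.derivative.eval v = -(k * (w - v)) := by
    have : (r.derivative.eval v + k * (w - v)) * (w - v) = 0 := by linear_combination -hk
    linear_combination (mul_eq_zero.1 this).resolve_right hvw
  have hd : v - 0 ∣ r.derivative.eval v - r.derivative.eval 0 := sub_dvd_eval_sub v 0 _
  rw [hk', h0, sub_zero] at hd
  obtain ⟨l, hl⟩ := hd
  apply hcoeff
  rw [← PadicInt.norm_int_lt_one_iff_dvd,
    show ((q.coeff (n - 1) : ℤ) : ℤ_[p]) = v * -l + (v + -w) * k by linear_combination -hl]
  have small : ∀ a b : ℤ_[p], ‖a‖ < 1 → ‖a * b‖ < 1 := fun a b ha => by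
    rw [norm_mul]
    exact mul_lt_one_of_nonneg_of_lt_one_left (norm_nonneg _) ha (PadicInt.norm_le_one b)
  have hvw' : ‖v + -w‖ < 1 :=
    (PadicInt.nonarchimedean _ _).trans_lt (max_lt hv (by rwa [norm_neg]))
  exact (PadicInt.nonarchimedean _ _).trans_lt (max_lt (small _ _ hv) (small _ _ hvw'))

-- The least prime factor of the denominator embeds the non-integral roots into the primes dividing
-- the leading coefficient.
open Polynomial in
theorem card_nonintegral_roots_le {q : ℤ[X]} {n : ℕ} (hn : 1 ≤ n) (hdeg : q.natDegree ≤ n)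
    (hlead : q.coeff n ≠ 0)
    (hcop : ∀ p : ℕ, p.Prime → (p : ℤ) ∣ q.coeff n → ¬ (p : ℤ) ∣ q.coeff (n - 1)) {Z : Finset ℚ}
    (hroot : ∀ z ∈ Z, aeval z q = 0) (hint : ∀ z ∈ Z, z.den ≠ 1) :
    Z.card ≤ (q.coeff n).natAbs.primeFactors.card := by
  refine Finset.card_le_card_of_injOn (fun z => z.den.minFac) (fun z hz => ?_) ?_
  · have hp := Nat.minFac_prime (hint z hz)
    refine Nat.mem_primeFactors.2 ⟨hp, ?_, by simpa using hlead⟩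
    exact Int.natCast_dvd.1 (dvd_coeff_of_dvd_den hdeg hp (hroot z hz) (Nat.minFac_dvd _))
  · intro x hx y hy hxy
    have hp := Nat.minFac_prime (hint x hx)
    refine eq_of_dvd_den hn hdeg hp (hcop _ hp ?_) (hroot x hx) (hroot y hy) (Nat.minFac_dvd _) ?_
    · exact dvd_coeff_of_dvd_den hdeg hp (hroot x hx) (Nat.minFac_dvd _)
    · simp only at hxy
      rw [hxy]
      exact Nat.minFac_dvd _

/-- All prime factors are odd, hence at least 3, and 2n + 1 < 3ⁿ. -/
theorem card_primeFactors_two_mul_add_one_lt {n : ℕ} (hn : 2 ≤ n) :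
    (2 * n + 1).primeFactors.card < n := by
  have h1 : 3 ^ (2 * n + 1).primeFactors.card ≤ 2 * n + 1 := by
    refine le_trans ?_ (Nat.le_of_dvd (by omega) (Nat.prod_primeFactors_dvd (2 * n + 1)))
    refine Finset.pow_card_le_prod _ _ _ fun p hp => ?_
    have hp' := Nat.mem_primeFactors.1 hp
    refine lt_of_le_of_ne hp'.1.two_le ?_
    rintro rfl
    omega
  have h2 : 2 * n + 1 < 3 ^ n := by
    clear h1
    induction n, hn using Nat.le_induction with
    | base => norm_num
    | succ k hk ih => rw [pow_succ]; omega
  exact (Nat.pow_lt_pow_iff_right (by norm_num)).1 (h1.trans_lt h2)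

/-! ### Chebyshev polynomials and the critical points of `U_{2n+1}` -/

open Polynomial in
/-- `U_{2k+1}` is `2X` times a polynomial in `4X²`. -/
theorem chebyshev_U_two_mul_add_one (R : Type*) [CommRing R] (k : ℕ) :
    Chebyshev.U R (2 * k + 1) = 2 * X * (Chebyshev.S R k).comp (4 * X ^ 2 - 2) := by
  -- Eliminating the terms of the other parity gives a recurrence of step two, which is that of `S`
  -- at 4X² - 2.
  have hrec : ∀ j : ℤ, Chebyshev.U R (j + 4) =
      (4 * X ^ 2 - 2) * Chebyshev.U R (j + 2) - Chebyshev.U R j := fun j => by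
    have h1 := Chebyshev.U_add_two R (j + 2)
    have h2 := Chebyshev.U_add_two R (j + 1)
    have h3 := Chebyshev.U_add_two R j
    rw [show j + 2 + 2 = j + 4 by ring, show j + 2 + 1 = j + 3 by ring] at h1
    rw [show j + 1 + 2 = j + 3 by ring, show j + 1 + 1 = j + 2 by ring] at h2
    linear_combination h1 + 2 * X * h2 + h3
  induction k using Nat.twoStepInduction with
  | zero => simp
  | one =>
    have h1 := hrec (-1)
    norm_num at h1 ⊢
    rw [h1]
    ring
  | more k ih1 ih2 =>
    have h1 := hrec (2 * k + 1)
    push_cast at ih2 ⊢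
    rw [show (2 * ((k : ℤ) + 1) + 1) = 2 * k + 1 + 2 by ring] at ih2
    rw [show (2 * ((k : ℤ) + 2) + 1) = 2 * k + 1 + 4 by ring, h1, ih1, ih2, Chebyshev.S_add_two]
    simp only [sub_comp, mul_comp, X_comp]
    ring

open Polynomial in
/-- The polynomial `g` with `U_{2n+1}(t) = 2t g(4t²)`. -/
noncomputable def oddChebyshevPart (n : ℕ) : ℤ[X] := (Chebyshev.S ℤ n).comp (X - 2)

open Polynomial in
/-- The polynomial `q` with `U_{2n+1}'(t) = 2 q(4t²)`. -/
noncomputable def gegenbauerSq (n : ℕ) : ℤ[X] :=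
  oddChebyshevPart n + 2 * X * derivative (oddChebyshevPart n)

open Polynomial in
theorem oddChebyshevPart_add_two (n : ℕ) :
    oddChebyshevPart (n + 2) = (X - 2) * oddChebyshevPart (n + 1) - oddChebyshevPart n := by
  simp only [oddChebyshevPart]
  push_cast
  rw [Chebyshev.S_add_two]
  simp

open Polynomial in
theorem oddChebyshevPart_coeffs (n : ℕ) :
    (oddChebyshevPart n).natDegree ≤ n ∧ (oddChebyshevPart n).coeff n = 1 ∧
      (oddChebyshevPart (n + 1)).coeff n = -2 * (n + 1) := by
  have h : ∀ k : ℕ, ((oddChebyshevPart k).natDegree ≤ k ∧ (oddChebyshevPart k).coeff k = 1) ∧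
      (oddChebyshevPart (k + 1)).natDegree ≤ k + 1 ∧
      (oddChebyshevPart (k + 1)).coeff (k + 1) = 1 ∧
      (oddChebyshevPart (k + 1)).coeff k = -2 * (k + 1) := by
    intro k
    induction k with
    | zero =>
      have h0 : oddChebyshevPart 0 = 1 := by simp [oddChebyshevPart]
      have h1 : oddChebyshevPart 1 = X - C 2 := by simp [oddChebyshevPart]
      refine ⟨by simp [h0], ?_, by simp [h1], by simp [h1]⟩
      rw [h1]
      exact natDegree_X_sub_C_le 2
    | succ k ih =>
      obtain ⟨⟨hd0, hc0⟩, hd1, hc1, hc2⟩ := ih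
      refine ⟨⟨hd1, hc1⟩, ?_⟩
      have hk : oddChebyshevPart (k + 1 + 1) =
          X * oddChebyshevPart (k + 1) - C 2 * oddChebyshevPart (k + 1) - oddChebyshevPart k := by
        rw [oddChebyshevPart_add_two, map_ofNat]
        ring
      rw [hk]
      refine ⟨?_, ?_, ?_⟩
      · compute_degree
        omega
      · rw [coeff_sub, coeff_sub, coeff_X_mul, coeff_C_mul, hc1,
          coeff_eq_zero_of_natDegree_lt (by omega), coeff_eq_zero_of_natDegree_lt (by omega)]
        norm_num
      · rw [coeff_sub, coeff_sub, coeff_X_mul, coeff_C_mul, hc1, hc2,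
          coeff_eq_zero_of_natDegree_lt (p := oddChebyshevPart k) (by omega)]
        push_cast
        ring
  exact ⟨(h n).1.1, (h n).1.2, (h n).2.2.2⟩

-- The factor 2j + 1 comes from differentiating t^(2j+1); it turns the monic g into a polynomial
-- with leading coefficient 2n + 1.
open Polynomial in
theorem gegenbauerSq_coeff (n j : ℕ) :
    (gegenbauerSq n).coeff j = (2 * j + 1) * (oddChebyshevPart n).coeff j := by
  rw [gegenbauerSq, mul_assoc, coeff_add, ← C_ofNat, coeff_C_mul]
  cases j with
  | zero => simp
  | succ j =>
    rw [coeff_X_mul, coeff_derivative]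
    push_cast
    ring

theorem natDegree_gegenbauerSq_le (n : ℕ) : (gegenbauerSq n).natDegree ≤ n := by
  refine Polynomial.natDegree_le_iff_coeff_eq_zero.2 fun j hj => ?_
  rw [gegenbauerSq_coeff, Polynomial.coeff_eq_zero_of_natDegree_lt
    ((oddChebyshevPart_coeffs n).1.trans_lt hj), mul_zero]

theorem gegenbauerSq_coeff_self (n : ℕ) : (gegenbauerSq n).coeff n = 2 * n + 1 := by
  rw [gegenbauerSq_coeff, (oddChebyshevPart_coeffs n).2.1, mul_one]

theorem gegenbauerSq_coeff_pred (n : ℕ) :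
    (gegenbauerSq (n + 1)).coeff n = -(2 * n + 1) * (2 * (n + 1)) := by
  rw [gegenbauerSq_coeff, (oddChebyshevPart_coeffs n).2.2]
  ring

open Polynomial in
theorem chebyshev_U_eval {K : Type*} [Field K] (n : ℕ) (t : K) :
    (Chebyshev.U K (2 * n + 1)).eval t = 2 * t * aeval (4 * t ^ 2) (oddChebyshevPart n) := by
  rw [chebyshev_U_two_mul_add_one, oddChebyshevPart, aeval_comp]
  simp [eval_comp, map_ofNat (aeval (4 * t ^ 2) : ℤ[X] →ₐ[ℤ] K) 2]

open Polynomial in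
theorem chebyshev_U_derivative_eval {K : Type*} [Field K] (n : ℕ) (t : K) :
    (derivative (Chebyshev.U K (2 * n + 1))).eval t = 2 * aeval (4 * t ^ 2) (gegenbauerSq n) := by
  have h : Chebyshev.U K (2 * n + 1) =
      2 * X * ((oddChebyshevPart n).map (Int.castRingHom K)).comp (4 * X ^ 2) := by
    rw [chebyshev_U_two_mul_add_one, oddChebyshevPart, Polynomial.map_comp, Chebyshev.map_S,
      comp_assoc]
    simp
  rw [h, gegenbauerSq, derivative_mul, derivative_comp]
  simp [derivative_map, eval_comp, aeval_def, eval_map, ← mul_assoc]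
  ring

open Polynomial in
/-- At a critical point of `U_{2n+1}`. -/
theorem chebyshev_U_sq_of_derivative_eq_zero {n : ℕ} {t : ℝ}
    (ht : (derivative (Chebyshev.U ℝ (2 * n + 1))).eval t = 0) :
    (Chebyshev.U ℝ (2 * n + 1)).eval t ^ 2 *
      ((2 * n + 2) ^ 2 - ((2 * n + 2) ^ 2 - 1) * t ^ 2) = (2 * n + 2) ^ 2 := by
  have h1 := congrArg (eval t) (Chebyshev.add_one_mul_T_eq_poly_in_U (R := ℝ) (2 * n + 1))
  have h2 := congrArg (eval t) (Chebyshev.T_eq_X_mul_U_sub_U ℝ (2 * n))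
  have h3 := congrArg (eval (2 * t)) (Chebyshev.S_sq_add_S_sq ℝ (2 * n))
  have hS : ∀ k : ℤ, eval (2 * t) (Chebyshev.S ℝ k) = eval t (Chebyshev.U ℝ k) := fun k => by
    rw [← Chebyshev.S_comp_two_mul_X]
    simp [eval_comp]
  rw [show (2 * (n : ℤ) + 1 + 1) = 2 * n + 2 by ring] at h1
  simp only [eval_mul, eval_add, eval_sub, eval_pow, eval_X, eval_one, eval_intCast, hS, ht] at h1 h2 h3
  push_cast at h1
  set y := eval t (Chebyshev.U ℝ (2 * n + 1))
  set v := eval t (Chebyshev.U ℝ (2 * n))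
  set T := eval t (Chebyshev.T ℝ (2 * n + 2))
  -- At a critical point (2n + 2)T_{2n+2} = tU_{2n+1}; T is then eliminated from the Pell identity
  -- T² + (1 - t²)U² = 1.
  have h4 : ((2 * n + 2 : ℝ) * T) ^ 2 = (t * y) ^ 2 := by
    congr 1
    linear_combination h1
  have h5 : T ^ 2 + y ^ 2 * (1 - t ^ 2) = 1 := by
    rw [h2]
    linear_combination h3
  linear_combination (2 * n + 2 : ℝ) ^ 2 * h5 - h4

open Polynomial in
theorem chebyshev_U_derivative_ode (n : ℕ) (t : ℝ) :
    (1 - t ^ 2) * (derivative (derivative (Chebyshev.U ℝ (2 * n + 1)))).eval t =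
      3 * t * (derivative (Chebyshev.U ℝ (2 * n + 1))).eval t -
        ((2 * n + 2) ^ 2 - 1) * (Chebyshev.U ℝ (2 * n + 1)).eval t := by
  have h := Chebyshev.one_sub_X_sq_mul_iterate_derivative_U_eval (R := ℝ) (2 * n + 1) 0 t
  simp only [Function.iterate_succ, Function.comp_apply, Function.iterate_zero, id] at h
  rw [h]
  push_cast
  ring

open Polynomial in
/-- The differential equation of the Gegenbauer polynomial `U_{2n+1}'`. -/
theorem gegenbauer_ode (n : ℕ) :
    (1 - X ^ 2) * derivative (derivative (derivative (Chebyshev.U ℝ (2 * n + 1)))) =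
      5 * X * derivative (derivative (Chebyshev.U ℝ (2 * n + 1))) -
        C ((2 * n : ℝ) * (2 * n + 4)) * derivative (Chebyshev.U ℝ (2 * n + 1)) := by
  refine Polynomial.funext fun t => ?_
  have h := Chebyshev.one_sub_X_sq_mul_iterate_derivative_U_eval (R := ℝ) (2 * n + 1) 1 t
  simp only [Function.iterate_succ, Function.comp_apply, Function.iterate_zero, id] at h
  simp only [eval_mul, eval_sub, eval_one, eval_pow, eval_X, eval_C, eval_ofNat]
  rw [h]
  push_cast
  ring

open Polynomial in
/-- No critical point `t` of `U_{2n+1}` has `4t²` an integer in `[0, 4]`. -/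
theorem four_mul_sq_ne_intCast {n : ℕ} (hn : 1 ≤ n) {t : ℝ} (ht1 : t ^ 2 ≤ 1)
    (ht : (derivative (Chebyshev.U ℝ (2 * n + 1))).eval t = 0) (k : ℤ) : 4 * t ^ 2 ≠ k := by
  intro hk
  have hsq := chebyshev_U_sq_of_derivative_eq_zero ht
  have hode := chebyshev_U_derivative_ode n t
  have hU := chebyshev_U_eval n t
  set y := (Chebyshev.U ℝ (2 * n + 1)).eval t
  obtain ⟨g, hg⟩ : ∃ g : ℤ, aeval (4 * t ^ 2) (oddChebyshevPart n) = (g : ℝ) := by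
    refine ⟨(oddChebyshevPart n).eval k, ?_⟩
    rw [hk]
    exact (aeval_algebraMap_apply_eq_algebraMap_eval (A := ℝ) k _)
  have hn' : (1 : ℝ) ≤ n := by exact_mod_cast hn
  -- The critical-point identity multiplied by 4, with U² = 4t²g² = kg².
  have hmain : k * g ^ 2 * (4 * (2 * n + 2) ^ 2 - ((2 * n + 2) ^ 2 - 1) * k) =
      4 * (2 * n + 2 : ℤ) ^ 2 := by
    have : (k * g ^ 2 * (4 * (2 * n + 2) ^ 2 - ((2 * n + 2) ^ 2 - 1) * k) : ℝ) =
        4 * (2 * n + 2) ^ 2 := by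
      rw [hU, hg] at hsq
      rw [← hk]
      linear_combination 4 * hsq
    exact_mod_cast this
  have hk0 : 0 ≤ k := by
    have : (0 : ℝ) ≤ k := by rw [← hk]; positivity
    exact_mod_cast this
  have hk4 : k < 4 := by
    -- At t² = 1 the differential equation would force U = 0, against the critical-point identity.
    have h4 : t ^ 2 ≠ 1 := by
      intro h1
      rw [ht, h1] at hode
      have hy : y = 0 := by
        have : ((2 * n + 2 : ℝ) ^ 2 - 1) * y = 0 := by linear_combination hode
        refine (mul_eq_zero.1 this).resolve_left ?_
        nlinarith
      rw [hy] at hsq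
      nlinarith
    have : (k : ℝ) < 4 := by
      rw [← hk]
      linarith [lt_of_le_of_ne ht1 h4]
    exact_mod_cast this
  have hn2 : (1 : ℤ) ≤ n := by exact_mod_cast hn
  have hg0 : g ^ 2 ≠ 0 := by
    intro h0
    rw [h0] at hmain
    nlinarith
  have hg1 : 0 < g ^ 2 := lt_of_le_of_ne (sq_nonneg g) hg0.symm
  -- With M = (2n + 2)²: k = 0 gives 0 = 4M; k = 1 gives g²(3M + 1) = 4M, so g² = 1 and M = 1; k = 2
  -- gives g²(M + 1) = M; k = 3 gives 3g²(M + 3) = 4M, so g² = 1 and M = 9, excluded because 2n + 2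
  -- is even.
  interval_cases k
  · nlinarith
  · have hlt : g ^ 2 < 2 := by nlinarith
    have : g ^ 2 = 1 := by omega
    rw [this] at hmain
    nlinarith
  · nlinarith
  · have hlt : g ^ 2 < 2 := by nlinarith
    have : g ^ 2 = 1 := by omega
    rw [this] at hmain
    have : (2 * (n : ℤ) + 2) ^ 2 = 3 ^ 2 := by linear_combination -hmain
    have := (pow_left_inj₀ (by omega) (by norm_num) two_ne_zero).1 this
    omega

open Polynomial in
/-- For `n ≥ 2`, fewer than `n` numbers `4t²`, `t` a critical point of `U_{2n+1}`, are rational. -/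
theorem card_lt_of_rational {n : ℕ} (hn : 2 ≤ n) {Z : Finset ℚ}
    (hZ : ∀ z ∈ Z, ∃ t : ℝ, t ^ 2 ≤ 1 ∧ 4 * t ^ 2 = z ∧
      (derivative (Chebyshev.U ℝ (2 * n + 1))).eval t = 0) : Z.card < n := by
  have hlead : (gegenbauerSq n).coeff n = ((2 * n + 1 : ℕ) : ℤ) := by
    rw [gegenbauerSq_coeff_self]
    push_cast
    rfl
  refine lt_of_le_of_lt ?_ (card_primeFactors_two_mul_add_one_lt hn)
  rw [← Int.natAbs_natCast (2 * n + 1), ← hlead]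
  refine card_nonintegral_roots_le (by omega) (natDegree_gegenbauerSq_le n) ?_ ?_ ?_ ?_
  · rw [hlead]
    exact_mod_cast (2 * n).succ_ne_zero
  · intro p hp h1 h2
    obtain ⟨m, rfl⟩ : ∃ m, n = m + 1 := ⟨n - 1, by omega⟩
    rw [Nat.add_sub_cancel, gegenbauerSq_coeff_pred] at h2
    rw [hlead] at h1
    -- Here n = m + 1. Modulo a prime p dividing 2n + 1, the product (2n - 1)(2n) is (-2)(-1) = 2,
    -- while p is odd.
    have h3 : (p : ℤ) ∣ 2 := by
      have e : (2 : ℤ) = (2 * m + 1) * (2 * (m + 1)) - (2 * m) * (2 * (m + 1) + 1) := by ring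
      rw [e]
      refine dvd_sub ((dvd_neg.2 h2).trans (dvd_of_eq (by ring))) (Dvd.dvd.mul_left ?_ _)
      exact_mod_cast h1
    have h4 : (p : ℤ) ∣ 1 := by
      have e : (1 : ℤ) = ((2 * (m + 1) + 1 : ℕ) : ℤ) - 2 * (m + 1) := by push_cast; ring
      rw [e]
      exact dvd_sub h1 (h3.mul_right _)
    exact hp.one_lt.ne' (Nat.dvd_one.1 (by exact_mod_cast h4))
  · intro z hz
    obtain ⟨t, -, htz, ht⟩ := hZ z hz
    rw [chebyshev_U_derivative_eval, htz] at ht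
    have h2 : aeval (algebraMap ℚ ℝ z) (gegenbauerSq n) = 0 := by simpa using ht
    rw [aeval_algebraMap_apply] at h2
    exact (map_eq_zero _).1 h2
  · intro z hz hden
    obtain ⟨t, ht1, htz, ht⟩ := hZ z hz
    refine four_mul_sq_ne_intCast (by omega) ht1 ht z.num ?_
    rw [htz]
    conv_lhs => rw [← Rat.num_div_den z, hden]
    simp

/-! ### Rationality of power sums and conjugate roots -/

open Polynomial in
/-- Power sums of the roots of a polynomial lie in the field generated by its coefficients. -/
theorem sum_pow_roots_mem (K : Subfield ℝ) {p : ℝ[X]} (hp : ∀ k, p.coeff k ∈ K) {T : Finset ℝ}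
    (hT : p.roots = T.val) (hcard : T.card = p.natDegree) (k : ℕ) : ∑ x ∈ T, x ^ k ∈ K := by
  rcases eq_or_ne p 0 with rfl | hp0
  · rw [natDegree_zero] at hcard
    rw [Finset.card_eq_zero.1 hcard, Finset.sum_empty]
    exact K.zero_mem
  have hroots : Multiset.card p.roots = p.natDegree := by rw [hT]; exact hcard
  -- Vieta's formulas handle the elementary symmetric functions; Newton's identities then give the
  -- power sums.
  have hes : ∀ j, T.val.esymm j ∈ K := fun j => by
    rcases le_or_gt j p.natDegree with hj | hj
    · have h := coeff_eq_esymm_roots_of_card hroots (Nat.sub_le p.natDegree j)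
      rw [Nat.sub_sub_self hj, hT] at h
      have hl : p.leadingCoeff * (-1) ^ j ≠ 0 :=
        mul_ne_zero (leadingCoeff_ne_zero.2 hp0) (pow_ne_zero _ (by norm_num))
      have h' : T.val.esymm j = p.coeff (p.natDegree - j) / (p.leadingCoeff * (-1) ^ j) := by
        rw [h, mul_div_cancel_left₀ _ hl]
      rw [h']
      exact K.div_mem (hp _) (K.mul_mem (hp _) (K.pow_mem (K.neg_mem K.one_mem) _))
    · rw [Multiset.esymm, Multiset.powersetCard_eq_empty _ (by rwa [Finset.card_val, hcard])]
      simp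
  have haes : ∀ j, MvPolynomial.aeval (fun i : T => (i : ℝ)) (MvPolynomial.esymm T ℝ j) ∈ K :=
    fun j => by
      rw [MvPolynomial.aeval_esymm_eq_multiset_esymm]
      convert hes j using 2
      exact congrArg Finset.val T.attach_map_val
  have hps : ∀ j, MvPolynomial.aeval (fun i : T => (i : ℝ)) (MvPolynomial.psum T ℝ j) =
      ∑ x ∈ T, x ^ j := fun j => by
    rw [MvPolynomial.psum, map_sum, ← Finset.sum_coe_sort T]
    simp
  induction k using Nat.strong_induction_on with
  | _ k ih =>
    rcases Nat.eq_zero_or_pos k with rfl | hk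
    · simp
    rw [← hps, MvPolynomial.psum_eq_mul_esymm_sub_sum T ℝ k hk]
    simp only [map_sub, map_mul, map_pow, map_neg, map_one, map_natCast, map_sum, hps]
    refine K.sub_mem (K.mul_mem (K.mul_mem (K.pow_mem (K.neg_mem K.one_mem) _)
      (natCast_mem K _)) (haes k)) (K.sum_mem fun a ha => ?_)
    rw [Finset.mem_filter, Finset.HasAntidiagonal.mem_antidiagonal] at ha
    exact K.mul_mem (K.mul_mem (K.pow_mem (K.neg_mem K.one_mem) _) (haes _))
      (ih _ (by have := ha.2.1; omega))

open Polynomial in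
/-- A monic rational quadratic divides every rational polynomial with which it shares an irrational
root. -/
theorem dvd_of_irrational_root {A Q : ℚ[X]} (hA : A.Monic) (hdeg : A.natDegree = 2) {x : ℝ}
    (hx : x ∉ Set.range ((↑) : ℚ → ℝ)) (hxA : aeval x A = 0) (hxQ : aeval x Q = 0) : A ∣ Q := by
  rw [← modByMonic_eq_zero_iff_dvd hA]
  have hd : (Q %ₘ A).natDegree ≤ 1 := by
    have := natDegree_modByMonic_lt Q hA (by rintro rfl; simp at hdeg)
    omega
  have h0 : aeval x (Q %ₘ A) = 0 := by
    rw [modByMonic_eq_sub_mul_div Q A, map_sub, map_mul, hxA, hxQ]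
    simp
  obtain ⟨a, b, hab⟩ := exists_eq_X_add_C_of_natDegree_le_one hd
  rw [hab] at h0 ⊢
  simp only [map_add, map_mul, aeval_C, aeval_X, eq_ratCast] at h0
  have ha : a = 0 := by
    by_contra ha
    refine hx ⟨-b / a, ?_⟩
    have ha' : (a : ℝ) ≠ 0 := by exact_mod_cast ha
    push_cast
    rw [div_eq_iff ha']
    linear_combination -h0
  subst ha
  have hb : b = 0 := by simpa using h0
  simp [hb]

/-! ### Nodes and weights of the Gauss quadrature -/

open Polynomial in
theorem natDegree_gegenbauer (n : ℕ) :
    (derivative (Chebyshev.U ℝ (2 * n + 1))).natDegree = 2 * n := by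
  have h1 : (Chebyshev.U ℝ (2 * n + 1)).natDegree = 2 * n + 1 := by
    exact_mod_cast Chebyshev.natDegree_U_natCast ℝ (2 * n + 1)
  rw [natDegree_derivative, h1, Nat.add_sub_cancel]

-- P is orthogonal to lower degrees because Df = (1 - t²)f'' - 5tf' is symmetric for W. Subtracting
-- `hW` for P'·X^k from `hW` for P·(X^k)' cancels the products of first derivatives. Since DP =
-- -2n(2n + 4)P and DX^k = k(k - 1)X^(k-2) - k(k + 4)X^k, induction on k in steps of two finishes,
-- the eigenvalues being distinct. For k = 2n - 1 the degree 4n - 2 is attained.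
open Polynomial in
theorem sum_weights_mul_gegenbauer_pow {n : ℕ} (T : Finset ℝ) (W : ℝ → ℝ)
    (hW : ∀ g : ℝ[X], g.natDegree ≤ 4 * n - 2 →
      ∑ t ∈ T, W t * ((1 - t ^ 2) * (derivative g).eval t - 5 * t * g.eval t) = 0)
    (k : ℕ) (hk : k < 2 * n) :
    ∑ t ∈ T, W t * ((derivative (Chebyshev.U ℝ (2 * n + 1))).eval t * t ^ k) = 0 := by
  set P := derivative (Chebyshev.U ℝ (2 * n + 1)) with hP
  have hPdeg : P.natDegree = 2 * n := natDegree_gegenbauer n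
  have hsymm : ∀ k : ℕ, k < 2 * n →
      k * (k - 1 : ℝ) * ∑ t ∈ T, W t * (P.eval t * t ^ (k - 2)) +
      (2 * n * (2 * n + 4) - k * (k + 4)) * ∑ t ∈ T, W t * (P.eval t * t ^ k) = 0 := by
    intro k hk
    have h1 := hW (P * derivative (X ^ k)) (by
      have := natDegree_mul_le (p := P) (q := derivative (X ^ k))
      have := natDegree_derivative_le (X ^ k : ℝ[X])
      rw [natDegree_X_pow] at this
      omega)
    have h2 := hW (derivative P * X ^ k) (by
      have h3 := natDegree_mul_le (p := derivative P) (q := X ^ k)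
      have h4 := natDegree_derivative_le P
      rw [natDegree_X_pow] at h3
      omega)
    rw [← sub_eq_zero.2 (h1.trans h2.symm), ← Finset.sum_sub_distrib, Finset.mul_sum,
      Finset.mul_sum, ← Finset.sum_add_distrib]
    refine Finset.sum_congr rfl fun t _ => ?_
    have h := congrArg (eval t) (gegenbauer_ode n)
    simp only [eval_mul, eval_sub, eval_one, eval_pow, eval_X, eval_C, eval_ofNat, ← hP] at h
    simp only [derivative_mul, eval_mul, eval_add, eval_pow, eval_X, derivative_X_pow,
      derivative_C, zero_mul, zero_add, eval_C]
    rcases k with _ | _ | k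
    · simp
      linear_combination (W t) * h
    · simp
      linear_combination (W t * t) * h
    · simp only [Nat.add_sub_cancel, show k + 1 + 1 - 2 = k by omega]
      push_cast
      linear_combination (W t * t ^ (k + 2)) * h
  induction k using Nat.strong_induction_on with
  | _ k ih =>
    have hne : ((2 * n : ℝ) * (2 * n + 4) - k * (k + 4)) ≠ 0 := by
      have : (k : ℝ) < 2 * n := by exact_mod_cast hk
      have : (0 : ℝ) ≤ k := k.cast_nonneg
      nlinarith
    refine (mul_eq_zero.1 (?_ : ((2 * n : ℝ) * (2 * n + 4) - k * (k + 4)) * _ = 0)).resolve_left hne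
    rw [← hsymm k hk, eq_comm, add_eq_right]
    rcases k with _ | _ | k
    · simp
    · simp
    · rw [show k + 1 + 1 - 2 = k by omega, ih k (by omega) (by omega), mul_zero]

open Polynomial in
/-- The nodes of the quadrature formula are the roots of the Gegenbauer polynomial. -/
theorem gegenbauer_roots_eq {n : ℕ} {T : Finset ℝ} (hT : T.card = 2 * n) {W : ℝ → ℝ}
    (hW0 : ∀ t ∈ T, W t ≠ 0)
    (hW : ∀ g : ℝ[X], g.natDegree ≤ 4 * n - 2 →
      ∑ t ∈ T, W t * ((1 - t ^ 2) * (derivative g).eval t - 5 * t * g.eval t) = 0) :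
    (derivative (Chebyshev.U ℝ (2 * n + 1))).roots = T.val := by
  set P := derivative (Chebyshev.U ℝ (2 * n + 1)) with hP
  have hdeg : P.natDegree = 2 * n := natDegree_gegenbauer n
  have hP0 : P ≠ 0 := by
    rintro h
    -- If P vanished identically, the equation at t = 1 would contradict U_{2n+1}(1) = 2n + 2.
    have h1 := chebyshev_U_derivative_ode n 1
    rw [← hP, h] at h1
    have h2 := Chebyshev.U_eval_one ℝ (2 * n + 1)
    rw [h2] at h1
    push_cast at h1
    simp at h1
    have : (0 : ℝ) ≤ n := n.cast_nonneg
    rcases h1 with h1 | h1 <;> nlinarith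
  have horth : ∀ f : ℝ[X], f.natDegree < 2 * n → ∑ t ∈ T, W t * (P.eval t * f.eval t) = 0 := by
    intro f hf
    simp_rw [eval_eq_sum_range' hf, Finset.mul_sum]
    rw [Finset.sum_comm]
    refine Finset.sum_eq_zero fun k hk => ?_
    have h := sum_weights_mul_gegenbauer_pow T W hW k (Finset.mem_range.1 hk)
    rw [← mul_zero (f.coeff k), ← h, Finset.mul_sum]
    refine Finset.sum_congr rfl fun t _ => ?_
    rw [← hP]
    ring
  have hroot : ∀ t ∈ T, P.eval t = 0 := by
    intro t ht
    have hcard : (T.erase t).card < 2 * n := by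
      rw [← hT]
      exact Finset.card_erase_lt_of_mem ht
    -- The nodal polynomial of the other 2n - 1 nodes isolates the term W(t)P(t).
    have h := horth (Lagrange.nodal (T.erase t) id) (by rwa [Lagrange.natDegree_nodal])
    rw [Finset.sum_eq_single_of_mem t ht] at h
    · have hne : eval t (Lagrange.nodal (T.erase t) id) ≠ 0 := by
        rw [Lagrange.eval_nodal]
        exact Finset.prod_ne_zero_iff.2 fun s hs =>
          sub_ne_zero.2 (Finset.ne_of_mem_erase hs).symm
      exact (mul_eq_zero.1 ((mul_eq_zero.1 h).resolve_left (hW0 t ht))).resolve_right hne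
    · intro s hs hst
      rw [show s = id s from rfl, Lagrange.eval_nodal_at_node (Finset.mem_erase.2 ⟨hst, hs⟩)]
      ring
  have hle : T.val ≤ P.roots := Finset.val_le_iff_val_subset.2 fun t ht =>
    (mem_roots hP0).2 (hroot t ht)
  refine (Multiset.eq_of_le_of_card_le hle ?_).symm
  rw [Finset.card_val, hT, ← hdeg]
  exact card_roots' P

open Polynomial in
/-- The products of the weights with `(1 - t²) P'(t)²` agree at all nodes. -/
theorem weights_mul_derivative_sq_eq {n : ℕ} {T : Finset ℝ} (hT : T.card = 2 * n) {W : ℝ → ℝ}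
    (hW : ∀ g : ℝ[X], g.natDegree ≤ 4 * n - 2 →
      ∑ t ∈ T, W t * ((1 - t ^ 2) * (derivative g).eval t - 5 * t * g.eval t) = 0)
    {P : ℝ[X]} (hdeg : P.natDegree = 2 * n) (hroots : P.roots = T.val) {a b : ℝ} (ha : a ∈ T)
    (hb : b ∈ T) :
    W a * (1 - a ^ 2) * (derivative P).eval a ^ 2 =
      W b * (1 - b ^ 2) * (derivative P).eval b ^ 2 := by
  rcases eq_or_ne a b with rfl | hab
  · rfl
  have hb' : b ∈ T.erase a := Finset.mem_erase.2 ⟨hab.symm, hb⟩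
  have hP0 : ∀ t ∈ T, P.eval t = 0 := fun t ht =>
    isRoot_of_mem_roots (by rw [hroots]; exact ht)
  set f := Lagrange.nodal ((T.erase a).erase b) id with hf
  have hfac : P = C P.leadingCoeff * ((X - C a) * ((X - C b) * f)) := by
    have h := C_leadingCoeff_mul_prod_multiset_X_sub_C (p := P)
      (by rw [hroots, Finset.card_val, hT, hdeg])
    rw [hroots] at h
    conv_lhs => rw [← h]
    congr 1
    rw [hf, Lagrange.nodal]
    have h2 := Finset.mul_prod_erase (T.erase a) (fun t : ℝ => X - C (id t)) hb'
    simp only [id] at h2 ⊢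
    rw [h2]
    exact (Finset.mul_prod_erase T (fun t : ℝ => X - C t) ha).symm
  have hfdeg : f.natDegree ≤ 2 * n - 2 := by
    rw [hf, Lagrange.natDegree_nodal, Finset.card_erase_of_mem hb', Finset.card_erase_of_mem ha,
      hT]
    omega
  have hn : 2 ≤ T.card := Finset.one_lt_card.2 ⟨a, ha, b, hb, hab⟩
  -- Up to a scalar, f is P/((X - a)(X - b)). At a node (Pf)' = P'f, which vanishes except at a and
  -- b, where f is proportional to P'(a)/(a - b) and P'(b)/(b - a).
  have h := hW (P * f) (natDegree_mul_le.trans (by omega))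
  have hf0 : ∀ t ∈ T, t ≠ a → t ≠ b → f.eval t = 0 := fun t ht hta htb => by
    rw [hf, show t = id t from rfl, Lagrange.eval_nodal_at_node]
    exact Finset.mem_erase.2 ⟨htb, Finset.mem_erase.2 ⟨hta, ht⟩⟩
  have hsum : W a * (1 - a ^ 2) * (derivative P).eval a * f.eval a +
      W b * (1 - b ^ 2) * (derivative P).eval b * f.eval b = 0 := by
    rw [← h, ← Finset.add_sum_erase T _ ha, ← Finset.add_sum_erase _ _ hb',
      Finset.sum_eq_zero (s := (T.erase a).erase b)]
    · simp only [derivative_mul, eval_add, eval_mul, hP0 a ha, hP0 b hb]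
      ring
    · intro t ht
      have ht1 := Finset.mem_erase.1 ht
      have ht2 := Finset.mem_erase.1 ht1.2
      simp only [derivative_mul, eval_add, eval_mul, hP0 t ht2.2, hf0 t ht2.2 ht2.1 ht1.1]
      ring
  have hda : (derivative P).eval a = P.leadingCoeff * ((a - b) * f.eval a) := by
    conv_lhs => rw [hfac]
    simp
  have hdb : (derivative P).eval b = P.leadingCoeff * ((b - a) * f.eval b) := by
    conv_lhs => rw [hfac]
    simp
  calc _ = P.leadingCoeff * (a - b) * (W a * (1 - a ^ 2) * (derivative P).eval a * f.eval a) := by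
        rw [hda]; ring
    _ = -P.leadingCoeff * (a - b) * (W b * (1 - b ^ 2) * (derivative P).eval b * f.eval b) := by
        linear_combination P.leadingCoeff * (a - b) * hsum
    _ = _ := by rw [hdb]; ring

/-- Up to scaling, the weight of the Gauss quadrature formula on `S⁵` at a node `t`. -/
def gaussWeight (n : ℕ) (t : ℝ) : ℝ :=
  (1 - t ^ 2) * ((2 * n + 2) ^ 2 - ((2 * n + 2) ^ 2 - 1) * t ^ 2)

-- W is proportional to 1/((1 - t²)P'²). At a node (1 - t²)P' = -(M - 1)U and U²(M - (M - 1)t²) = M,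
-- so all derivatives disappear. Cross-multiplying avoids dividing by 1 - t².
open Polynomial in
theorem weights_mul_gaussWeight_eq {n : ℕ} (hn : 1 ≤ n) {T : Finset ℝ} (hT : T.card = 2 * n)
    {W : ℝ → ℝ} (hW0 : ∀ t ∈ T, W t ≠ 0)
    (hW : ∀ g : ℝ[X], g.natDegree ≤ 4 * n - 2 →
      ∑ t ∈ T, W t * ((1 - t ^ 2) * (derivative g).eval t - 5 * t * g.eval t) = 0)
    {a b : ℝ} (ha : a ∈ T) (hb : b ∈ T) :
    W a * gaussWeight n b = W b * gaussWeight n a := by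
  have hroots := gegenbauer_roots_eq hT hW0 hW
  have key := weights_mul_derivative_sq_eq hT hW (natDegree_gegenbauer n) hroots ha hb
  have hP0 : ∀ t ∈ T, (derivative (Chebyshev.U ℝ (2 * n + 1))).eval t = 0 := fun t ht =>
    isRoot_of_mem_roots (by rw [hroots]; exact ht)
  have ha1 := chebyshev_U_derivative_ode n a
  have hb1 := chebyshev_U_derivative_ode n b
  have ha2 := chebyshev_U_sq_of_derivative_eq_zero (hP0 a ha)
  have hb2 := chebyshev_U_sq_of_derivative_eq_zero (hP0 b hb)
  rw [hP0 a ha] at ha1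
  rw [hP0 b hb] at hb1
  have hn' : (1 : ℝ) ≤ n := by exact_mod_cast hn
  unfold gaussWeight
  set M : ℝ := (2 * n + 2) ^ 2 with hM
  have hM1 : 1 < M := by rw [hM]; nlinarith
  generalize eval a (derivative (derivative (Chebyshev.U ℝ (2 * n + 1)))) = Pa at *
  generalize eval b (derivative (derivative (Chebyshev.U ℝ (2 * n + 1)))) = Pb at *
  generalize eval a (Chebyshev.U ℝ (2 * n + 1)) = ya at *
  generalize eval b (Chebyshev.U ℝ (2 * n + 1)) = yb at *
  have hc : (M - 1) ^ 2 * M ≠ 0 := mul_ne_zero (pow_ne_zero _ (by linarith)) (by linarith)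
  refine mul_left_cancel₀ hc ?_
  have e1 : W a * (1 - b ^ 2) * ((M - 1) * ya) ^ 2 = W b * (1 - a ^ 2) * ((M - 1) * yb) ^ 2 := by
    have ea : (M - 1) * ya = -((1 - a ^ 2) * Pa) := by linear_combination ha1
    have eb : (M - 1) * yb = -((1 - b ^ 2) * Pb) := by linear_combination hb1
    rw [ea, eb]
    linear_combination (1 - a ^ 2) * (1 - b ^ 2) * key
  calc _ = W a * (1 - b ^ 2) * (M - 1) ^ 2 * (M - (M - 1) * b ^ 2) *
        (ya ^ 2 * (M - (M - 1) * a ^ 2)) := by rw [ha2]; ring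
    _ = W b * (1 - a ^ 2) * (M - 1) ^ 2 * (M - (M - 1) * a ^ 2) *
        (yb ^ 2 * (M - (M - 1) * b ^ 2)) := by
        linear_combination (M - (M - 1) * a ^ 2) * (M - (M - 1) * b ^ 2) * e1
    _ = _ := by rw [hb2]; ring

/-! ### Integral weights force rational squares of the nodes -/

noncomputable section

-- Summing the proportionality over all nodes expresses the value at a as W(a)/ΣW, which is
-- rational, times a rational combination of power sums of the roots of P.
open Polynomial in
theorem gaussWeight_mem_range {n : ℕ} (hn : 1 ≤ n) {T : Finset ℝ} (hT : T.card = 2 * n)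
    {W : ℝ → ℕ} (hW0 : ∀ t ∈ T, W t ≠ 0)
    (hW : ∀ g : ℝ[X], g.natDegree ≤ 4 * n - 2 →
      ∑ t ∈ T, (W t : ℝ) * ((1 - t ^ 2) * (derivative g).eval t - 5 * t * g.eval t) = 0)
    {a : ℝ} (ha : a ∈ T) : ∃ r : ℚ, gaussWeight n a = r := by
  have hW0' : ∀ t ∈ T, (W t : ℝ) ≠ 0 := fun t ht => by exact_mod_cast hW0 t ht
  have hroots := gegenbauer_roots_eq (W := fun t => (W t : ℝ)) hT hW0' hW
  set K : Subfield ℝ := (algebraMap ℚ ℝ).fieldRange with hK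
  have hcoeff : ∀ k, (derivative (Chebyshev.U ℝ (2 * n + 1))).coeff k ∈ K := fun k => by
    rw [← Chebyshev.map_U (algebraMap ℚ ℝ), derivative_map, coeff_map]
    exact ⟨_, rfl⟩
  have hcard : T.card = (derivative (Chebyshev.U ℝ (2 * n + 1))).natDegree := by
    rw [hT, natDegree_gegenbauer]
  have hps := sum_pow_roots_mem K hcoeff hroots hcard
  have hM : (2 * n + 2 : ℝ) ^ 2 ∈ K := ⟨(2 * n + 2) ^ 2, by simp⟩
  have hsum : ∑ t ∈ T, gaussWeight n t ∈ K := by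
    have h : ∑ t ∈ T, gaussWeight n t = (2 * n + 2) ^ 2 * ∑ t ∈ T, t ^ 0 -
        (2 * (2 * n + 2) ^ 2 - 1) * ∑ t ∈ T, t ^ 2 + ((2 * n + 2) ^ 2 - 1) * ∑ t ∈ T, t ^ 4 := by
      simp only [Finset.mul_sum, ← Finset.sum_sub_distrib, ← Finset.sum_add_distrib, gaussWeight]
      exact Finset.sum_congr rfl fun t _ => by ring
    rw [h]
    have h2 : (2 : ℝ) ∈ K := ofNat_mem K 2
    exact K.add_mem (K.sub_mem (K.mul_mem hM (hps 0))
      (K.mul_mem (K.sub_mem (K.mul_mem h2 hM) K.one_mem) (hps 2)))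
      (K.mul_mem (K.sub_mem hM K.one_mem) (hps 4))
  have htot : (0 : ℝ) < ∑ t ∈ T, (W t : ℝ) :=
    Finset.sum_pos (fun t ht => lt_of_le_of_ne (Nat.cast_nonneg _) (hW0' t ht).symm) ⟨a, ha⟩
  have hval : gaussWeight n a = (W a * ∑ t ∈ T, gaussWeight n t) / ∑ t ∈ T, (W t : ℝ) := by
    rw [eq_div_iff htot.ne', Finset.mul_sum, Finset.mul_sum]
    refine Finset.sum_congr rfl fun t ht => ?_
    rw [weights_mul_gaussWeight_eq hn (W := fun t => (W t : ℝ)) hT hW0' hW ha ht, mul_comm]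
  have hmem : gaussWeight n a ∈ K := by
    rw [hval]
    exact K.div_mem (K.mul_mem (natCast_mem K _) hsum) (K.sum_mem fun t _ => natCast_mem K _)
  obtain ⟨r, hr⟩ := hmem
  exact ⟨r, by rw [← hr]; rfl⟩

open Polynomial in
theorem four_mul_sq_rational {n : ℕ} (hn : 1 ≤ n) {a : ℝ} (ha1 : a ^ 2 ≤ 1)
    (hroot : (derivative (Chebyshev.U ℝ (2 * n + 1))).eval a = 0)
    (hbound : ∀ t : ℝ, (derivative (Chebyshev.U ℝ (2 * n + 1))).eval t = 0 → t ^ 2 ≤ 1)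
    (hrat : ∃ r : ℚ, gaussWeight n a = r) : 4 * a ^ 2 ∈ Set.range ((↑) : ℚ → ℝ) := by
  obtain ⟨r, hr⟩ := hrat
  by_contra hirr
  have hn' : (1 : ℚ) ≤ n := by exact_mod_cast hn
  obtain ⟨M, hM⟩ : ∃ M : ℚ, M = (2 * n + 2) ^ 2 := ⟨_, rfl⟩
  have hM1 : 0 < M - 1 := by rw [hM]; nlinarith
  have hMR : ((M : ℚ) : ℝ) = (2 * n + 2) ^ 2 := by rw [hM]; push_cast; rfl
  have hM1R : (0 : ℝ) < M - 1 := by exact_mod_cast hM1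
  unfold gaussWeight at hr
  rw [← hMR] at hr
  -- With y = 4a², the equation `gaussWeight n a = r` reads y² - By + D = 0. The conjugate root is B
  -- - y > 4 because B > 8 and y ≤ 4.
  set B : ℚ := 8 + 4 / (M - 1) with hB
  set D : ℚ := 16 * (M - r) / (M - 1) with hD
  set A : ℚ[X] := X ^ 2 + (C (-B) * X + C D) with hA
  have hAdeg : (C (-B) * X + C D).natDegree ≤ 1 := natDegree_linear_le
  have hAmonic : A.Monic := monic_X_pow_add (degree_linear_le.trans_lt (by norm_num))
  have hAnat : A.natDegree = 2 := by
    rw [hA]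
    compute_degree!
  have hAeval : ∀ x : ℝ, aeval x A = x ^ 2 - B * x + D := fun x => by
    simp [hA]
    ring
  have hAa : aeval (4 * a ^ 2) A = 0 := by
    rw [hAeval, hB, hD]
    push_cast
    field_simp
    linear_combination 16 * hr
  set Q : ℚ[X] := (gegenbauerSq n).map (Int.castRingHom ℚ) with hQ
  have hQeval : ∀ x : ℝ, aeval x Q = aeval x (gegenbauerSq n) := fun x =>
    aeval_map_algebraMap ℚ x (gegenbauerSq n)
  have hQa : aeval (4 * a ^ 2) Q = 0 := by
    rw [chebyshev_U_derivative_eval] at hroot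
    rw [hQeval]
    exact (mul_eq_zero.1 hroot).resolve_left two_ne_zero
  obtain ⟨F, hF⟩ := dvd_of_irrational_root hAmonic hAnat hirr hAa hQa
  set x : ℝ := B - 4 * a ^ 2 with hx
  have hx4 : 4 < x := by
    have h1 : (0 : ℝ) < 4 / (M - 1) := by positivity
    have h2 : (B : ℝ) = 8 + 4 / (M - 1) := by rw [hB]; push_cast; rfl
    rw [hx, h2]
    linarith
  have hxA : aeval x A = 0 := by
    rw [hAeval] at hAa ⊢
    rw [hx]
    linear_combination hAa
  have hxQ : aeval x (gegenbauerSq n) = 0 := by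
    rw [← hQeval, hF, map_mul, hxA, zero_mul]
  have hsq : 4 * Real.sqrt (x / 4) ^ 2 = x := by
    rw [Real.sq_sqrt (by linarith)]
    ring
  have := hbound (Real.sqrt (x / 4)) (by rw [chebyshev_U_derivative_eval, hsq, hxQ, mul_zero])
  linarith

open Polynomial in
/-- There is no Gauss quadrature formula on `S⁵` with `2n ≥ 4` nodes and integral weights. -/
theorem lt_two_of_integral_gauss_quadrature {n : ℕ} {T : Finset ℝ} (hT : T.card = 2 * n)
    (hT1 : ∀ t ∈ T, t ^ 2 ≤ 1) {W : ℝ → ℕ} (hW0 : ∀ t ∈ T, W t ≠ 0)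
    (hW : ∀ g : ℝ[X], g.natDegree ≤ 4 * n - 2 →
      ∑ t ∈ T, (W t : ℝ) * ((1 - t ^ 2) * (derivative g).eval t - 5 * t * g.eval t) = 0) :
    n < 2 := by
  by_contra! hn
  have hroots := gegenbauer_roots_eq (W := fun t => (W t : ℝ)) hT
    (fun t ht => by exact_mod_cast hW0 t ht) hW
  have hne : derivative (Chebyshev.U ℝ (2 * n + 1)) ≠ 0 := by
    intro h
    have := natDegree_gegenbauer n
    rw [h, natDegree_zero] at this
    omega
  have hmem : ∀ t : ℝ, (derivative (Chebyshev.U ℝ (2 * n + 1))).eval t = 0 ↔ t ∈ T := fun t => by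
    rw [← Finset.mem_val, ← hroots, mem_roots hne, IsRoot]
  have hrat : ∀ t : ℝ, ∃ r : ℚ, t ∈ T → (r : ℝ) = 4 * t ^ 2 := fun t => by
    by_cases ht : t ∈ T
    · obtain ⟨r, hr⟩ := four_mul_sq_rational (by omega) (hT1 t ht) ((hmem t).2 ht)
        (fun s hs => hT1 s ((hmem s).1 hs)) (gaussWeight_mem_range (by omega) hT hW0 hW ht)
      exact ⟨r, fun _ => hr⟩
    · exact ⟨0, fun h => absurd h ht⟩
  choose r hr using hrat
  have hlt : (T.image r).card < n := by
    refine card_lt_of_rational hn fun z hz => ?_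
    obtain ⟨t, ht, rfl⟩ := Finset.mem_image.1 hz
    exact ⟨t, hT1 t ht, (hr t ht).symm, (hmem t).2 ht⟩
  -- The map t ↦ 4t² is at most two-to-one.
  have hle : T.card ≤ 2 * (T.image r).card := by
    refine Finset.card_le_mul_card_image T 2 fun z hz => ?_
    obtain ⟨t, ht, rfl⟩ := Finset.mem_image.1 hz
    refine (Finset.card_le_card (t := {t, -t}) fun s hs => ?_).trans Finset.card_le_two
    obtain ⟨hs1, hs2⟩ := Finset.mem_filter.1 hs
    have h : s ^ 2 = t ^ 2 := by
      have h1 := hr s hs1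
      rw [hs2, hr t ht] at h1
      linarith
    rw [Finset.mem_insert, Finset.mem_singleton]
    exact sq_eq_sq_iff_eq_or_eq_neg.1 h
  omega

end

/-! ### Zonal polynomials and spherical designs -/

noncomputable section

/-- The action of a linear isometry on the unit sphere. -/
def sphereMap {d : ℕ} (R : EuclideanSpace ℝ (Fin d) ≃ₗᵢ[ℝ] EuclideanSpace ℝ (Fin d))
    (x : UnitSphere d) : UnitSphere d :=
  ⟨R x, by simp⟩

theorem continuous_sphereMap {d : ℕ}
    (R : EuclideanSpace ℝ (Fin d) ≃ₗᵢ[ℝ] EuclideanSpace ℝ (Fin d)) : Continuous (sphereMap R) :=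
  (R.continuous.comp continuous_subtype_val).subtype_mk _

-- The surface measure of s is a multiple of the volume of the cone over s, and isometries carry
-- cones to cones.
open scoped Pointwise in
theorem map_sphereMap_surfaceMeasure {d : ℕ}
    (R : EuclideanSpace ℝ (Fin d) ≃ₗᵢ[ℝ] EuclideanSpace ℝ (Fin d)) :
    (surfaceMeasure d).map (sphereMap R) = surfaceMeasure d := by
  have hm := (continuous_sphereMap R).measurable
  ext s hs
  rw [Measure.map_apply hm hs, surfaceMeasure, Measure.toSphere_apply' _ (hm hs),
    Measure.toSphere_apply' _ hs]
  congr 1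
  have h := R.measurePreserving.measure_preimage_emb R.toHomeomorph.measurableEmbedding
    (Set.Ioo (0 : ℝ) 1 • (Subtype.val '' s))
  rw [← h]
  congr 1
  ext v
  simp only [Set.mem_smul, Set.mem_image, Set.mem_preimage]
  constructor
  · rintro ⟨r, hr, _, ⟨x, hx, rfl⟩, rfl⟩
    exact ⟨r, hr, _, ⟨_, hx, rfl⟩, (R.map_smul r x).symm⟩
  · rintro ⟨r, hr, _, ⟨x, hx, rfl⟩, h⟩
    refine ⟨r, hr, _, ⟨sphereMap R.symm x, ?_, rfl⟩, ?_⟩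
    · have : sphereMap R (sphereMap R.symm x) = x := Subtype.ext (R.apply_symm_apply _)
      rwa [this]
    · apply R.injective
      rw [← h]
      simp [sphereMap]

theorem integral_comp_sphereMap {d : ℕ}
    (R : EuclideanSpace ℝ (Fin d) ≃ₗᵢ[ℝ] EuclideanSpace ℝ (Fin d)) {h : UnitSphere d → ℝ}
    (hh : Continuous h) :
    ∫ x, h (sphereMap R x) ∂(surfaceMeasure d) = ∫ x, h x ∂(surfaceMeasure d) := by
  conv_rhs => rw [← map_sphereMap_surfaceMeasure R]
  exact (integral_map (continuous_sphereMap R).measurable.aemeasurable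
    hh.aestronglyMeasurable).symm

/-- Integrals of zonal functions do not depend on the pole. -/
theorem integral_zonal_eq {d : ℕ} (a b : UnitSphere d) {f : ℝ → ℝ} (hf : Continuous f) :
    ∫ x : UnitSphere d, f (inner ℝ (a : EuclideanSpace ℝ (Fin d)) x) ∂(surfaceMeasure d) =
      ∫ x : UnitSphere d, f (inner ℝ (b : EuclideanSpace ℝ (Fin d)) x) ∂(surfaceMeasure d) := by
  -- The reflection in the hyperplane orthogonal to a - b takes a to b, as their norms agree.
  let R := Submodule.reflection (ℝ ∙ ((a : EuclideanSpace ℝ (Fin d)) - b))ᗮ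
  have hR : R a = (b : EuclideanSpace ℝ (Fin d)) := Submodule.reflection_sub (by simp)
  rw [← integral_comp_sphereMap R
    (h := fun x : UnitSphere d => f (inner ℝ (b : EuclideanSpace ℝ (Fin d)) x)) (by fun_prop)]
  refine integral_congr_ae (Filter.Eventually.of_forall fun x => ?_)
  simp only [sphereMap]
  rw [← hR, R.inner_map_map]

/-- The polynomial `f(⟨a, x⟩)` in the coordinates of `x`. -/
def zonalPolynomial {d : ℕ} (a : UnitSphere d) (f : Polynomial ℝ) : MvPolynomial (Fin d) ℝ :=
  Polynomial.aeval
    (∑ i, MvPolynomial.C ((a : EuclideanSpace ℝ (Fin d)) i) * MvPolynomial.X i) f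

theorem evalOnSphere_zonalPolynomial {d : ℕ} (a x : UnitSphere d) (f : Polynomial ℝ) :
    evalOnSphere (zonalPolynomial a f) x =
      f.eval (inner ℝ (a : EuclideanSpace ℝ (Fin d)) (x : EuclideanSpace ℝ (Fin d))) := by
  rw [evalOnSphere, zonalPolynomial, Polynomial.aeval_def, Polynomial.hom_eval₂,
    PiLp.inner_apply, Polynomial.eval]
  congr 1
  · ext r
    simp [MvPolynomial.algebraMap_eq]
  · simp [mul_comm]

theorem totalDegree_zonalPolynomial_le {d : ℕ} (a : UnitSphere d) (f : Polynomial ℝ) :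
    (zonalPolynomial a f).totalDegree ≤ f.natDegree := by
  rw [zonalPolynomial, Polynomial.aeval_eq_sum_range]
  refine MvPolynomial.totalDegree_finsetSum_le fun i hi => ?_
  refine (MvPolynomial.totalDegree_smul_le _ _).trans ((MvPolynomial.totalDegree_pow _ _).trans ?_)
  have h1 : (∑ i, MvPolynomial.C ((a : EuclideanSpace ℝ (Fin d)) i) *
      MvPolynomial.X i : MvPolynomial (Fin d) ℝ).totalDegree ≤ 1 := by
    refine MvPolynomial.totalDegree_finsetSum_le fun j _ => ?_
    refine (MvPolynomial.totalDegree_mul _ _).trans ?_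
    rw [MvPolynomial.totalDegree_C, MvPolynomial.totalDegree_X]
  calc i * _ ≤ i * 1 := Nat.mul_le_mul_left i h1
    _ ≤ f.natDegree := by rw [mul_one]; exact Nat.lt_succ_iff.1 (Finset.mem_range.1 hi)

theorem surfaceMeasure_real_univ_pos {d : ℕ} [NeZero d] :
    0 < (surfaceMeasure d).real Set.univ := by
  have : Nontrivial (EuclideanSpace ℝ (Fin d)) := by
    refine Module.nontrivial_of_finrank_pos (R := ℝ) ?_
    rw [finrank_euclideanSpace_fin]
    exact Nat.pos_of_ne_zero (NeZero.ne d)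
  have h0 : surfaceMeasure d ≠ 0 := Measure.toSphere_ne_zero _
  have : IsFiniteMeasure (surfaceMeasure d) := by
    unfold surfaceMeasure
    infer_instance
  have : NeZero (surfaceMeasure d) := ⟨h0⟩
  exact measureReal_univ_pos

/-- Sums of zonal polynomials over a design do not depend on the pole. -/
theorem IsSphericalDesign.sum_zonal_eq {d t : ℕ} {X : Finset (UnitSphere d)}
    (hX : IsSphericalDesign t X) (a b : UnitSphere d) {f : Polynomial ℝ} (hf : f.natDegree ≤ t) :
    ∑ x ∈ X, f.eval (inner ℝ (a : EuclideanSpace ℝ (Fin d)) (x : EuclideanSpace ℝ (Fin d))) =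
      ∑ x ∈ X, f.eval (inner ℝ (b : EuclideanSpace ℝ (Fin d)) (x : EuclideanSpace ℝ (Fin d))) := by
  have ha := hX.2 (zonalPolynomial a f) ((totalDegree_zonalPolynomial_le a f).trans hf)
  have hb := hX.2 (zonalPolynomial b f) ((totalDegree_zonalPolynomial_le b f).trans hf)
  simp only [evalOnSphere_zonalPolynomial] at ha hb
  rw [integral_zonal_eq a b f.continuous, ← hb] at ha
  have hc : (1 / (X.card : ℝ)) ≠ 0 :=
    one_div_ne_zero (Nat.cast_ne_zero.2 (Finset.card_ne_zero.2 hX.1))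
  exact mul_left_cancel₀ hc ha

open Polynomial in
theorem exists_derivative_eq (g : ℝ[X]) :
    ∃ f : ℝ[X], derivative f = g ∧ f.natDegree ≤ g.natDegree + 1 := by
  refine ⟨∑ i ∈ Finset.range (g.natDegree + 1), C (g.coeff i / (i + 1)) * X ^ (i + 1), ?_, ?_⟩
  · conv_rhs => rw [g.as_sum_range_C_mul_X_pow]
    rw [derivative_sum]
    refine Finset.sum_congr rfl fun i _ => ?_
    rw [derivative_C_mul_X_pow, Nat.add_sub_cancel]
    congr 2
    push_cast
    field_simp
  · refine natDegree_sum_le_of_forall_le _ _ fun i hi => (natDegree_C_mul_X_pow_le _ _).trans ?_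
    exact Finset.mem_range.1 hi

/-- The point `cos φ e₀ + sin φ e_j` of the sphere. -/
def circlePoint {d : ℕ} [NeZero d] (j : Fin d) (hj : j ≠ 0) (φ : ℝ) : UnitSphere d :=
  ⟨EuclideanSpace.single 0 (Real.cos φ) + EuclideanSpace.single j (Real.sin φ), by
    rw [mem_sphere_zero_iff_norm, ← sq_eq_sq₀ (norm_nonneg _) zero_le_one, norm_add_sq_real]
    rw [EuclideanSpace.inner_single_left]
    simp [hj.symm]⟩

theorem inner_circlePoint {d : ℕ} [NeZero d] (j : Fin d) (hj : j ≠ 0) (φ : ℝ)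
    (x : EuclideanSpace ℝ (Fin d)) :
    inner ℝ (circlePoint j hj φ : EuclideanSpace ℝ (Fin d)) x =
      Real.cos φ * x 0 + Real.sin φ * x j := by
  simp [circlePoint, inner_add_left, EuclideanSpace.inner_single_left]

/-- The first coordinate vector. -/
def pole (d : ℕ) [NeZero d] : UnitSphere d := ⟨EuclideanSpace.single 0 1, by simp⟩

theorem inner_pole {d : ℕ} [NeZero d] (x : EuclideanSpace ℝ (Fin d)) :
    inner ℝ (pole d : EuclideanSpace ℝ (Fin d)) x = x 0 := by
  simp [pole, EuclideanSpace.inner_single_left]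

-- For f' = g, the sum of f(⟨y, x⟩) over the design is constant as y moves along the circle through
-- e₀ and e_j; the identity is its second derivative at e₀.
open Polynomial in
theorem IsSphericalDesign.sum_pole_coord {d t : ℕ} [NeZero d] {X : Finset (UnitSphere d)}
    (hX : IsSphericalDesign t X) {g : ℝ[X]} (hg : g.natDegree + 1 ≤ t) {j : Fin d} (hj : j ≠ 0) :
    ∑ x ∈ X, ((derivative g).eval (x.1 0) * x.1 j ^ 2 - x.1 0 * g.eval (x.1 0)) = 0 := by
  obtain ⟨f, hf, hfdeg⟩ := exists_derivative_eq g
  have hconst : ∀ φ : ℝ, ∑ x ∈ X, f.eval (Real.cos φ * x.1 0 + Real.sin φ * x.1 j) =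
      ∑ x ∈ X, f.eval (x.1 0) := fun φ => by
    have h := hX.sum_zonal_eq (circlePoint j hj φ) (pole d) (hfdeg.trans hg)
    simpa only [inner_circlePoint, inner_pole] using h
  have hc : ∀ (x : UnitSphere d) (φ : ℝ), HasDerivAt
      (fun φ => Real.cos φ * x.1 0 + Real.sin φ * x.1 j)
      (-Real.sin φ * x.1 0 + Real.cos φ * x.1 j) φ := fun x φ =>
    ((Real.hasDerivAt_cos φ).mul_const _).add ((Real.hasDerivAt_sin φ).mul_const _)
  have hc' : ∀ (x : UnitSphere d) (φ : ℝ), HasDerivAt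
      (fun φ => -Real.sin φ * x.1 0 + Real.cos φ * x.1 j)
      (-Real.cos φ * x.1 0 + -Real.sin φ * x.1 j) φ := fun x φ =>
    ((Real.hasDerivAt_sin φ).neg.mul_const _).add ((Real.hasDerivAt_cos φ).mul_const _)
  have h1 : ∀ φ : ℝ, ∑ x ∈ X, g.eval (Real.cos φ * x.1 0 + Real.sin φ * x.1 j) *
      (-Real.sin φ * x.1 0 + Real.cos φ * x.1 j) = 0 := fun φ => by
    have h := HasDerivAt.fun_sum (u := X) fun x _ => ((f.hasDerivAt _).comp φ (hc x φ))
    simp only [Function.comp_def, hconst, hf] at h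
    exact h.unique (hasDerivAt_const φ _)
  have h2 := HasDerivAt.fun_sum (u := X) fun x _ =>
    (((g.hasDerivAt _).comp (0 : ℝ) (hc x 0)).mul (hc' x 0))
  simp only [Function.comp_def, Pi.mul_def, h1] at h2
  have h3 := h2.unique (hasDerivAt_const 0 _)
  rw [← h3]
  refine Finset.sum_congr rfl fun x _ => ?_
  simp
  ring

theorem sum_sq_coord {d : ℕ} (x : UnitSphere d) : ∑ i, x.1 i ^ 2 = 1 := by
  have h := EuclideanSpace.norm_sq_eq x.1
  rw [norm_eq_of_mem_sphere x] at h
  simpa using h.symm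

open Polynomial in
/-- The Pearson identity of the zonal measure. -/
theorem IsSphericalDesign.sum_pearson {d t : ℕ} [NeZero d] {X : Finset (UnitSphere d)}
    (hX : IsSphericalDesign t X) (z : UnitSphere d) {g : ℝ[X]} (hg : g.natDegree + 1 ≤ t) :
    ∑ x ∈ X, ((1 - inner ℝ z.1 x.1 ^ 2) * (derivative g).eval (inner ℝ z.1 x.1) -
      (d - 1) * inner ℝ z.1 x.1 * g.eval (inner ℝ z.1 x.1)) = 0 := by
  have hdeg : ((1 - Polynomial.X ^ 2) * derivative g -
      C (d - 1 : ℝ) * Polynomial.X * g).natDegree ≤ t := by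
    refine (natDegree_sub_le_of_le (m := g.natDegree + 1) (n := g.natDegree + 1)
      ?_ ?_).trans ((max_self _).trans_le hg)
    · rcases Nat.eq_zero_or_pos g.natDegree with h0 | h0
      · rw [derivative_of_natDegree_zero h0]
        simp
      · refine natDegree_mul_le.trans ?_
        have h1 : (1 - Polynomial.X ^ 2 : ℝ[X]).natDegree ≤ 2 := by compute_degree
        have h2 := natDegree_derivative_le g
        omega
    · refine natDegree_mul_le.trans ?_
      have h1 : (C (d - 1 : ℝ) * Polynomial.X).natDegree ≤ 1 := by compute_degree
      omega
  have h := hX.sum_zonal_eq z (pole d) hdeg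
  simp only [inner_pole] at h
  simp only [eval_sub, eval_mul, eval_one, eval_pow, eval_X, eval_C] at h
  rw [h]
  -- With z moved to e₀, the identities for all j ≠ 0 are added up; the squares x_j² sum to 1 - x₀².
  have hs : ∑ j ∈ Finset.univ.erase (0 : Fin d),
      ∑ x ∈ X, ((derivative g).eval (x.1 0) * x.1 j ^ 2 - x.1 0 * g.eval (x.1 0)) = 0 :=
    Finset.sum_eq_zero fun j hj => hX.sum_pole_coord hg (Finset.ne_of_mem_erase hj)
  rw [Finset.sum_comm] at hs
  rw [← hs]
  refine Finset.sum_congr rfl fun x _ => ?_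
  have hx := sum_sq_coord x
  rw [← Finset.add_sum_erase _ _ (Finset.mem_univ (0 : Fin d))] at hx
  rw [Finset.sum_sub_distrib, ← Finset.mul_sum, Finset.sum_const,
    Finset.card_erase_of_mem (Finset.mem_univ _), Finset.card_univ, Fintype.card_fin,
    nsmul_eq_mul, Nat.cast_sub (Nat.pos_of_ne_zero (NeZero.ne d))]
  push_cast
  linear_combination (-(derivative g).eval (x.1 0)) * hx

open Polynomial in
/-- A spherical `(2m-1)`-design has at least `m` inner products with any point. -/
theorem IsSphericalDesign.le_card_innerProducts {d m : ℕ} (hd : 2 ≤ d)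
    {X : Finset (UnitSphere d)} (hX : IsSphericalDesign (2 * m - 1) X) (z : UnitSphere d) :
    m ≤ (innerProducts z X).card := by
  by_contra! hlt
  set T := innerProducts z X with hT
  -- The zonal sum of w² vanishes at z, hence at every pole. Being a sum of squares it vanishes
  -- termwise, so T contains every inner product with p.
  set w := Lagrange.nodal T (id : ℝ → ℝ) with hw
  have hwdeg : (w ^ 2).natDegree ≤ 2 * m - 1 := by
    rw [natDegree_pow, hw, Lagrange.natDegree_nodal]
    omega
  obtain ⟨p, hp⟩ := hX.1
  have hmem : ∀ a : UnitSphere d, inner ℝ a.1 p.1 ∈ T := by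
    intro a
    have h := hX.sum_zonal_eq a z hwdeg
    rw [Finset.sum_eq_zero (s := X) (f := fun x => eval (inner ℝ z.1 x.1) (w ^ 2))] at h
    · have h0 := (Finset.sum_eq_zero_iff_of_nonneg fun x _ => by
        rw [eval_pow]; exact sq_nonneg _).1 h p hp
      rw [eval_pow, sq_eq_zero_iff, hw, Lagrange.eval_nodal, Finset.prod_eq_zero_iff] at h0
      obtain ⟨t, ht, h1⟩ := h0
      rw [sub_eq_zero.1 h1]
      exact ht
    · intro x hx
      have hx' : inner ℝ z.1 x.1 ∈ T := Finset.mem_image_of_mem _ hx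
      rw [eval_pow, hw]
      have := Lagrange.eval_nodal_at_node (v := (id : ℝ → ℝ)) hx'
      rw [id] at this
      rw [this]
      norm_num
  -- For d ≥ 2 connectedness makes these inner products fill [-1, 1], which is infinite.
  have hconn : IsPreconnected (Metric.sphere (0 : EuclideanSpace ℝ (Fin d)) 1) := by
    refine isPreconnected_sphere ?_ _ _
    rw [← Module.finrank_eq_rank, finrank_euclideanSpace_fin]
    exact_mod_cast hd
  have hsub : Set.Icc (-1 : ℝ) 1 ⊆ (T : Set ℝ) := by
    have h := hconn.intermediate_value (f := fun a => inner ℝ a p.1) (-p).2 p.2 (by fun_prop)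
    simp only [coe_neg_sphere, inner_neg_left, real_inner_self_eq_norm_sq,
      norm_eq_of_mem_sphere, one_pow] at h
    refine h.trans ?_
    rintro _ ⟨a, ha, rfl⟩
    exact hmem ⟨a, ha⟩
  exact (Set.Icc_infinite (by norm_num : (-1 : ℝ) < 1)) (T.finite_toSet.subset hsub)

/-- The weights are the multiplicities of the inner products, hence positive integers; the strength
4n - 1 allows test polynomials of degree 4n - 2. -/
theorem lt_two_of_isStiff {n : ℕ} {X : Finset (UnitSphere 6)} (hX : IsStiff (2 * n) X) : n < 2 := by
  obtain ⟨hn, hdes, z, hz⟩ := hX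
  have hcard : (innerProducts z X).card = 2 * n :=
    le_antisymm hz (hdes.le_card_innerProducts (by norm_num) z)
  refine lt_two_of_integral_gauss_quadrature hcard (T := innerProducts z X)
    (W := fun t => (X.filter fun x => inner ℝ z.1 x.1 = t).card) ?_ ?_ ?_
  · intro t ht
    obtain ⟨x, -, rfl⟩ := Finset.mem_image.1 ht
    rw [sq_le_one_iff_abs_le_one]
    simpa using abs_real_inner_le_norm z.1 x.1
  · intro t ht
    obtain ⟨x, hx, rfl⟩ := Finset.mem_image.1 ht
    exact Finset.card_ne_zero.2 ⟨x, Finset.mem_filter.2 ⟨hx, rfl⟩⟩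
  · intro g hg
    have h := hdes.sum_pearson z (g := g) (by omega)
    have h2 := Finset.sum_comp (s := X) (fun t : ℝ => (1 - t ^ 2) * (Polynomial.derivative g).eval t -
      ((6 : ℕ) - 1) * t * g.eval t) (fun x : UnitSphere 6 => inner ℝ z.1 x.1)
    rw [h2] at h
    rw [← h]
    refine Finset.sum_congr rfl fun t _ => ?_
    rw [nsmul_eq_mul]
    norm_num

end

/-! ### The cube as a 3-design -/

noncomputable section

/-- The normalized mean of a polynomial over the sphere. -/
def sphereMean (d : ℕ) (f : MvPolynomial (Fin d) ℝ) : ℝ :=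
  (1 / (surfaceMeasure d).real Set.univ) * ∫ x, evalOnSphere f x ∂(surfaceMeasure d)

theorem continuous_evalOnSphere {d : ℕ} (f : MvPolynomial (Fin d) ℝ) :
    Continuous (evalOnSphere f) :=
  (MvPolynomial.continuous_eval f).comp (by fun_prop)

theorem integrable_evalOnSphere {d : ℕ} (f : MvPolynomial (Fin d) ℝ) :
    Integrable (evalOnSphere f) (surfaceMeasure d) := by
  have : IsFiniteMeasure (surfaceMeasure d) := by
    unfold surfaceMeasure
    infer_instance
  exact (continuous_evalOnSphere f).integrable_of_hasCompactSupport
    (HasCompactSupport.of_compactSpace _)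

theorem isLinearMap_sphereMean (d : ℕ) : IsLinearMap ℝ (sphereMean d) where
  map_add f g := by
    simp only [sphereMean]
    rw [← mul_add, ← integral_add (integrable_evalOnSphere f) (integrable_evalOnSphere g)]
    simp [evalOnSphere]
  map_smul c f := by
    simp only [sphereMean]
    rw [smul_eq_mul, mul_left_comm, ← integral_const_mul c]
    simp only [evalOnSphere, MvPolynomial.smul_eval]

theorem sphereMean_one (d : ℕ) [NeZero d] : sphereMean d 1 = 1 := by
  simp [sphereMean, evalOnSphere, surfaceMeasure_real_univ_pos.ne']

theorem evalOnSphere_monomial {d : ℕ} (α : Fin d →₀ ℕ) (x : UnitSphere d) :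
    evalOnSphere (MvPolynomial.monomial α 1) x = ∏ j, x.1 j ^ α j := by
  simp [evalOnSphere, MvPolynomial.eval_monomial, Finsupp.prod_fintype]

theorem sphereMean_monomial_of_odd {d : ℕ} {α : Fin d →₀ ℕ} {i : Fin d} (hi : Odd (α i)) :
    sphereMean d (MvPolynomial.monomial α 1) = 0 := by
  let R : EuclideanSpace ℝ (Fin d) ≃ₗᵢ[ℝ] EuclideanSpace ℝ (Fin d) :=
    LinearIsometryEquiv.piLpCongrRight 2 fun j =>
      if j = i then LinearIsometryEquiv.neg ℝ else LinearIsometryEquiv.refl ℝ ℝ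
  have hR : ∀ (x : EuclideanSpace ℝ (Fin d)) j, R x j = (if j = i then -1 else 1) * x j := by
    intro x j
    by_cases h : j = i <;> simp [R, h]
  have h := integral_comp_sphereMap R (continuous_evalOnSphere (MvPolynomial.monomial α 1))
  have hneg : ∀ x, evalOnSphere (MvPolynomial.monomial α 1) (sphereMap R x) =
      -evalOnSphere (MvPolynomial.monomial α 1) x := fun x => by
    rw [evalOnSphere_monomial, evalOnSphere_monomial]
    simp only [sphereMap, hR, mul_pow, Finset.prod_mul_distrib]
    simp [ite_pow, Finset.prod_ite_eq', hi.neg_one_pow]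
  simp only [hneg, integral_neg] at h
  rw [sphereMean, show ∫ x, evalOnSphere (MvPolynomial.monomial α 1) x ∂(surfaceMeasure d) = 0 by
    linarith, mul_zero]

/-- The d means agree by symmetry and add up to the mean of 1. -/
theorem sphereMean_X_sq {d : ℕ} [NeZero d] (i : Fin d) :
    sphereMean d (MvPolynomial.X i ^ 2) = 1 / d := by
  have heq : ∀ j, sphereMean d (MvPolynomial.X j ^ 2) = sphereMean d (MvPolynomial.X i ^ 2) := by
    intro j
    have h := integral_zonal_eq (d := d) ⟨EuclideanSpace.single j 1, by simp⟩
      ⟨EuclideanSpace.single i 1, by simp⟩ (f := fun t => t ^ 2) (by fun_prop)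
    simp only [EuclideanSpace.inner_single_left, map_one, one_mul] at h
    simp [sphereMean, evalOnSphere, h]
  have hsum : ∑ j, sphereMean d (MvPolynomial.X j ^ 2) = 1 := by
    rw [← sphereMean_one d]
    have h1 : ∑ j, sphereMean d (MvPolynomial.X j ^ 2) =
        sphereMean d (∑ j, MvPolynomial.X j ^ 2) :=
      (map_sum ((isLinearMap_sphereMean d).mk' _) _ _).symm
    rw [h1, sphereMean, sphereMean]
    congr 2
    ext x
    simpa [evalOnSphere] using sum_sq_coord x
  have hd : (d : ℝ) ≠ 0 := Nat.cast_ne_zero.2 (NeZero.ne d)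
  rw [Finset.sum_congr rfl fun j _ => heq j, Finset.sum_const, Finset.card_univ, Fintype.card_fin,
    nsmul_eq_mul] at hsum
  rw [eq_div_iff hd, mul_comm]
  exact hsum

theorem even_exponent_cases {d : ℕ} {α : Fin d →₀ ℕ} (hα : α.degree ≤ 3) (heven : ∀ i, Even (α i)) :
    α = 0 ∨ ∃ i, α = Finsupp.single i 2 := by
  by_cases h0 : α = 0
  · exact Or.inl h0
  obtain ⟨i, hi⟩ := Finsupp.ne_iff.1 h0
  rw [Finsupp.zero_apply] at hi
  have hsum := Finsupp.degree_eq_sum α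
  rw [← Finset.add_sum_erase _ _ (Finset.mem_univ i)] at hsum
  obtain ⟨k, hk⟩ := heven i
  refine Or.inr ⟨i, Finsupp.ext fun j => ?_⟩
  rcases eq_or_ne i j with rfl | hij
  · rw [Finsupp.single_eq_same]
    omega
  · rw [Finsupp.single_eq_of_ne hij.symm]
    have hj := Finset.single_le_sum (f := fun j => α j) (fun _ _ => Nat.zero_le _)
      (Finset.mem_erase.2 ⟨hij.symm, Finset.mem_univ j⟩)
    obtain ⟨l, hl⟩ := heven j
    omega

/-- A linear functional on polynomials with the symmetries of the cube is determined in degree at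
most three. -/
theorem linear_functional_eq_sphereMean {d : ℕ} [NeZero d] {A : MvPolynomial (Fin d) ℝ → ℝ}
    (hA : IsLinearMap ℝ A) (h1 : A 1 = 1)
    (hodd : ∀ (α : Fin d →₀ ℕ) i, Odd (α i) → A (MvPolynomial.monomial α 1) = 0)
    (hsq : ∀ i, A (MvPolynomial.X i ^ 2) = 1 / d) {f : MvPolynomial (Fin d) ℝ}
    (hf : f.totalDegree ≤ 3) : A f = sphereMean d f := by
  have hmon : ∀ α : Fin d →₀ ℕ, α.degree ≤ 3 →
      A (MvPolynomial.monomial α 1) = sphereMean d (MvPolynomial.monomial α 1) := by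
    intro α hα
    by_cases h : ∃ i, Odd (α i)
    · obtain ⟨i, hi⟩ := h
      rw [hodd α i hi, sphereMean_monomial_of_odd hi]
    · push Not at h
      rcases even_exponent_cases hα fun i => Nat.not_odd_iff_even.1 (h i) with rfl | ⟨i, rfl⟩
      · exact h1.trans (sphereMean_one d).symm
      · rw [← MvPolynomial.X_pow_eq_monomial, hsq, sphereMean_X_sq]
  have hexp : ∀ {B : MvPolynomial (Fin d) ℝ → ℝ}, IsLinearMap ℝ B →
      B f = ∑ α ∈ f.support, f.coeff α * B (MvPolynomial.monomial α 1) := fun {B} hB => by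
    conv_lhs => rw [f.as_sum]
    refine (map_sum (hB.mk' B) _ _).trans (Finset.sum_congr rfl fun α _ => ?_)
    rw [← smul_eq_mul, ← hB.map_smul, MvPolynomial.smul_monomial, smul_eq_mul, mul_one]
    rfl
  rw [hexp hA, hexp (isLinearMap_sphereMean d)]
  refine Finset.sum_congr rfl fun α hα => ?_
  rw [hmon α ((MvPolynomial.le_totalDegree hα).trans hf)]

/-- The vertex of the cube inscribed in the unit sphere with the given signs. -/
def cubeVertex {d : ℕ} [NeZero d] (ε : Fin d → ℤˣ) : UnitSphere d :=
  ⟨WithLp.toLp 2 fun i => ((ε i : ℤ) : ℝ) / Real.sqrt d, by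
    have hd : (d : ℝ) ≠ 0 := Nat.cast_ne_zero.2 (NeZero.ne d)
    rw [mem_sphere_zero_iff_norm, ← sq_eq_sq₀ (norm_nonneg _) zero_le_one,
      EuclideanSpace.norm_sq_eq]
    have h : ∀ i, (((ε i : ℤ) : ℝ)) ^ 2 = 1 := fun i => by
      rcases Int.units_eq_one_or (ε i) with h | h <;> simp [h]
    simp [div_pow, h, hd]⟩

theorem cubeVertex_apply {d : ℕ} [NeZero d] (ε : Fin d → ℤˣ) (i : Fin d) :
    (cubeVertex ε).1 i = ((ε i : ℤ) : ℝ) / Real.sqrt d := rfl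

theorem cubeVertex_injective {d : ℕ} [NeZero d] :
    Function.Injective (cubeVertex : (Fin d → ℤˣ) → UnitSphere d) := by
  intro ε δ h
  have hd : Real.sqrt d ≠ 0 :=
    Real.sqrt_ne_zero'.2 (Nat.cast_pos.2 (Nat.pos_of_ne_zero (NeZero.ne d)))
  ext i
  have h1 : (cubeVertex ε).1 i = (cubeVertex δ).1 i := by rw [h]
  rw [cubeVertex_apply, cubeVertex_apply, div_left_inj' hd] at h1
  exact_mod_cast h1

/-- The vertices of the cube inscribed in the unit sphere. -/
def cubeVertices (d : ℕ) [NeZero d] : Finset (UnitSphere d) :=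
  Finset.univ.map ⟨cubeVertex, cubeVertex_injective⟩

/-- Sign changes of one coordinate permute the vertices and kill odd monomials, and each squared
coordinate is constantly 1/d. -/
theorem isSphericalDesign_cubeVertices (d : ℕ) [NeZero d] :
    IsSphericalDesign 3 (cubeVertices d) := by
  have hd : (d : ℝ) ≠ 0 := Nat.cast_ne_zero.2 (NeZero.ne d)
  have hne : (cubeVertices d).Nonempty := by simp [cubeVertices]
  have hc : ((cubeVertices d).card : ℝ) ≠ 0 := Nat.cast_ne_zero.2 (Finset.card_ne_zero.2 hne)
  have hsign : ∀ u : ℤˣ, (((u : ℤ) : ℝ)) ^ 2 = 1 := fun u => by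
    rcases Int.units_eq_one_or u with h | h <;> simp [h]
  refine ⟨hne, fun f hf => linear_functional_eq_sphereMean
    (A := fun f => (1 / ((cubeVertices d).card : ℝ)) * ∑ x ∈ cubeVertices d, evalOnSphere f x)
    ⟨fun f g => ?_, fun c f => ?_⟩ ?_ (fun α i hi => ?_) (fun i => ?_) hf⟩
  · simp [evalOnSphere, Finset.sum_add_distrib, mul_add]
  · simp only [evalOnSphere, MvPolynomial.smul_eval, smul_eq_mul]
    rw [← Finset.mul_sum, mul_left_comm]
  · simp [evalOnSphere, hc]
  · have hneg : ∀ ε : Fin d → ℤˣ,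
        evalOnSphere (MvPolynomial.monomial α 1) (cubeVertex (Pi.mulSingle i (-1) * ε)) =
          -evalOnSphere (MvPolynomial.monomial α 1) (cubeVertex ε) := fun ε => by
      rw [evalOnSphere_monomial, evalOnSphere_monomial, ← Finset.mul_prod_erase _ _ (Finset.mem_univ i),
        ← Finset.mul_prod_erase _ _ (Finset.mem_univ i), ← neg_mul]
      congr 1
      · rw [cubeVertex_apply, cubeVertex_apply, ← hi.neg_pow]
        simp [neg_div]
      · refine Finset.prod_congr rfl fun j hj => ?_
        rw [cubeVertex_apply, cubeVertex_apply, Pi.mul_apply,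
          Pi.mulSingle_eq_of_ne (Finset.ne_of_mem_erase hj), one_mul]
    have h := Equiv.sum_comp (Equiv.mulLeft (Pi.mulSingle i (-1) : Fin d → ℤˣ)) fun ε =>
      evalOnSphere (MvPolynomial.monomial α 1) (cubeVertex ε)
    simp only [Equiv.coe_mulLeft, hneg, Finset.sum_neg_distrib] at h
    simp only [cubeVertices, Finset.sum_map, Function.Embedding.coeFn_mk]
    rw [show ∑ ε : Fin d → ℤˣ, evalOnSphere (MvPolynomial.monomial α 1) (cubeVertex ε) = 0 by
      linarith, mul_zero]
  · have hval : ∀ x ∈ cubeVertices d, evalOnSphere (MvPolynomial.X i ^ 2) x = 1 / d := by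
      intro x hx
      obtain ⟨ε, -, rfl⟩ := Finset.mem_map.1 hx
      simp only [evalOnSphere, map_pow, MvPolynomial.eval_X, Function.Embedding.coeFn_mk,
        cubeVertex_apply, div_pow, hsign]
      rw [Real.sq_sqrt (Nat.cast_nonneg d)]
    rw [Finset.sum_congr rfl hval, Finset.sum_const, nsmul_eq_mul]
    field_simp

/-- The vertices of the cube form a `2`-stiff configuration. -/
theorem isStiff_cubeVertices (d : ℕ) [NeZero d] : IsStiff 2 (cubeVertices d) := by
  refine ⟨two_pos, isSphericalDesign_cubeVertices d, pole d, ?_⟩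
  refine (Finset.card_le_card (t := {1 / Real.sqrt d, -1 / Real.sqrt d}) fun t ht => ?_).trans
    Finset.card_le_two
  obtain ⟨x, hx, rfl⟩ := Finset.mem_image.1 ht
  obtain ⟨ε, -, rfl⟩ := Finset.mem_map.1 hx
  rw [inner_pole, Finset.mem_insert, Finset.mem_singleton, Function.Embedding.coeFn_mk,
    cubeVertex_apply]
  rcases Int.units_eq_one_or (ε 0) with h | h <;> simp [h]

end

theorem mainTheorem12 (n : ℕ) (hn : 1 ≤ n) :
    (∃ X : Finset (UnitSphere 6), IsStiff (2 * n) X) ↔ n = 1 := by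
  constructor
  · rintro ⟨X, hX⟩
    have := lt_two_of_isStiff hX
    omega
  · rintro rfl
    exact ⟨cubeVertices 6, isStiff_cubeVertices 6⟩
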